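/- Let $X$ be an infinite compact Hausdorff space and let $A$ be a unital C*-algebra equipped with a unital $*$-homomorphism $\eta\colon C(X)\to Z(A)$ into the center of $A$ (a unital $C(X)$-algebra). For $x\in X$ let $A(x)=A/\eta(C_0(X\setminus\{x\}))A$ be the fiber at $x$, and let $a(x)$ be the image of $a\in A$ in $A(x)$. Suppose that $x\mapsto\|a(x)\|$ is continuous for every $a\in A$ (that is, $A$ is a continuous $C(X)$-algebra), and that every fiber $A(x)$ is nonzero and simple, i.e. has no closed two-sided ideals other than $0$ and $A(x)$. Let $h\colon X\to X$ be a minimal homeomorphism (the only closed sets $F\subseteq X$ with $h(F)=F$ are $\varnothing$ and $X$), and let $\alpha$ be a $*$-automorphism of $A$ which lies over $h$, i.e. $\alpha(\eta(f))=\eta(f\circ h^{-1})$ for all $f\in C(X)$. Then the crossed product C*-algebra $C^*(\mathbb{Z},A,\alpha)$ of $A$ by the action of $\mathbb{Z}$ generated by $\alpha$ is simple, i.e. it is nonzero and its only closed two-sided ideals are $0$ and itself. -/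

import Mathlib

open scoped ENNReal

noncomputable section

/-- A topological ring is (topologically) simple if it is nonzero and its only closed two-sided
ideals are `0` and the whole ring. -/
def IsTopologicallySimple (B : Type*) [Ring B] [TopologicalSpace B] : Prop :=
  Nontrivial B ∧ ∀ I : TwoSidedIdeal B, IsClosed (I : Set B) → I = ⊥ ∨ I = ⊤

/-- A homeomorphism `h` of `X` is minimal if the only closed subsets `F` with `h(F) = F` are
`∅` and `X`. -/
def IsMinimalHomeo {X : Type*} [TopologicalSpace X] (h : X ≃ₜ X) : Prop :=
  ∀ F : Set X, IsClosed F → h '' F = F → F = ∅ ∨ F = Set.univ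

/-! ### Unital `C(X)`-algebras -/

/-- The structure of a unital `C(X)`-algebra on a unital C*-algebra `A`: a unital
`*`-homomorphism from `C(X)` to the center of `A` (which is its own multiplier algebra). -/
structure CXAlgebra (X A : Type*) [TopologicalSpace X] [CompactSpace X] [CStarAlgebra A] where
  /-- the structure map -/
  η : C(X, ℂ) →⋆ₐ[ℂ] A
  central : ∀ f : C(X, ℂ), ∀ a : A, Commute (η f) a

namespace CXAlgebra

variable {X A : Type*} [TopologicalSpace X] [CompactSpace X] [CStarAlgebra A]

/-- The closed ideal `C₀(X ∖ {x}) A` of `A`. (By Cohen factorization the set of products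
`η f * a` with `f x = 0` is itself a closed ideal; here we take the closed ideal it generates.) -/
def fiberIdeal (S : CXAlgebra X A) (x : X) : Ideal A :=
  (Ideal.span {b : A | ∃ f : C(X, ℂ), ∃ a : A, f x = 0 ∧ b = S.η f * a}).closure

instance isTwoSided_fiberIdeal (S : CXAlgebra X A) (x : X) : (S.fiberIdeal x).IsTwoSided := by
  refine ⟨fun {a} b ha => ?_⟩
  have key : ∀ c ∈ Ideal.span {b : A | ∃ f : C(X, ℂ), ∃ a : A, f x = 0 ∧ b = S.η f * a},
      c * b ∈ Ideal.span {b : A | ∃ f : C(X, ℂ), ∃ a : A, f x = 0 ∧ b = S.η f * a} := by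
    intro c hc
    induction hc using Submodule.span_induction with
    | mem c hc =>
      obtain ⟨f, a, hf, rfl⟩ := hc
      exact Ideal.subset_span ⟨f, a * b, hf, mul_assoc _ _ _⟩
    | zero => simp
    | add y z _ _ hy hz => rw [add_mul]; exact Ideal.add_mem _ hy hz
    | smul r y _ hy => rw [smul_eq_mul, mul_assoc]; exact Ideal.mul_mem_left _ _ hy
  exact map_mem_closure (f := fun c : A => c * b) (by fun_prop) ha key

instance isClosed_fiberIdeal (S : CXAlgebra X A) (x : X) :
    IsClosed (S.fiberIdeal x : Set A) :=
  isClosed_closure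

/-- The fiber `A(x) = A / C₀(X ∖ {x}) A`, with the quotient ring structure and quotient norm. -/
abbrev Fiber (S : CXAlgebra X A) (x : X) : Type _ := A ⧸ S.fiberIdeal x

/-- The quotient map `π_x : A → A(x)`; `S.eval x a` is `a(x)`. -/
def eval (S : CXAlgebra X A) (x : X) : A →+* S.Fiber x := Ideal.Quotient.mk (S.fiberIdeal x)

/-- A `C(X)`-algebra is continuous if `x ↦ ‖a(x)‖` is continuous for every `a`. -/
def IsContinuous (S : CXAlgebra X A) : Prop :=
  ∀ a : A, Continuous fun x : X => ‖S.eval x a‖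

/-- The automorphism `α` of `A` lies over the homeomorphism `h` of `X`:
`α(η(f)) = η(f ∘ h⁻¹)` for all `f ∈ C(X)`. -/
def LiesOver (S : CXAlgebra X A) (α : A ≃⋆ₐ[ℂ] A) (h : X ≃ₜ X) : Prop :=
  ∀ f : C(X, ℂ), α (S.η f) = S.η (f.comp (h.symm : C(X, X)))

end CXAlgebra

/-! ### The (full) crossed product by an automorphism -/

universe u

/-- A covariant representation of `(A, ℤ, α)`: a unital representation `π` of `A` on a nonzero
complex Hilbert space `H` and a unitary `U` on `H` with `U π(a) U* = π(α(a))`. -/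
structure CovariantRep {A : Type u} [CStarAlgebra A] (α : A ≃⋆ₐ[ℂ] A) : Type (u + 1) where
  H : Type u
  [normedAddCommGroup : NormedAddCommGroup H]
  [innerProductSpace : InnerProductSpace ℂ H]
  [completeSpace : CompleteSpace H]
  [nontrivial : Nontrivial H]
  π : A →⋆ₐ[ℂ] (H →L[ℂ] H)
  U : unitary (H →L[ℂ] H)
  covariant : ∀ a : A, (U : H →L[ℂ] H) * π a * star (U : H →L[ℂ] H) = π (α a)

attribute [instance] CovariantRep.normedAddCommGroup CovariantRep.innerProductSpace
  CovariantRep.completeSpace CovariantRep.nontrivial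

namespace CrossedProduct

variable {A : Type u} [CStarAlgebra A] (α : A ≃⋆ₐ[ℂ] A)

/-- The C*-algebra of bounded families of operators, indexed by the covariant representations;
it contains the direct sum of all covariant representations. -/
abbrev Ambient : Type (u + 1) :=
  lp (fun ρ : CovariantRep α => ρ.H →L[ℂ] ρ.H) ∞

instance : CStarAlgebra (Ambient α) where

/-- The image of `a ∈ A` under the direct sum of all covariant representations. -/
def coeff (a : A) : Ambient α :=
  ⟨fun ρ => ρ.π a, memℓp_infty ⟨‖a‖, by
    rintro _ ⟨ρ, rfl⟩
    exact NonUnitalStarAlgHom.norm_apply_le ρ.π a⟩⟩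

/-- The canonical unitary: the direct sum of the unitaries of all covariant representations. -/
def canonicalUnitary : Ambient α :=
  ⟨fun ρ => (ρ.U : ρ.H →L[ℂ] ρ.H), memℓp_infty ⟨1, by
    rintro _ ⟨ρ, rfl⟩
    exact CStarRing.norm_coe_unitary ρ.U |>.le⟩⟩

end CrossedProduct

/-- The crossed product `C*(ℤ, A, α)`: the C*-algebra generated by the image of `A` and the
canonical unitary in the universal covariant representation (the direct sum of all covariant
representations). The norm of a finite sum `∑ aₙ uⁿ` is thus the supremum of
`‖∑ π(aₙ) Uⁿ‖` over all covariant representations `(π, U)`, which is the universal norm.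
Hilbert spaces in the universe of `A` suffice, because every covariant representation is a direct
sum of cyclic ones. -/
def CrossedProduct {A : Type u} [CStarAlgebra A] (α : A ≃⋆ₐ[ℂ] A) :
    StarSubalgebra ℂ (CrossedProduct.Ambient α) :=
  (StarAlgebra.adjoin ℂ
    (Set.range (CrossedProduct.coeff α) ∪ {CrossedProduct.canonicalUnitary α})).topologicalClosure

instance {A : Type u} [CStarAlgebra A] (α : A ≃⋆ₐ[ℂ] A) :
    IsClosed (CrossedProduct α : Set (CrossedProduct.Ambient α)) :=
  StarSubalgebra.isClosed_topologicalClosure _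

end

/-! Let `I` be a closed ideal of the crossed product and `J` its preimage in `A`, an `α`-invariant
closed ideal. The points where `J` vanishes in the fiber form a closed set, by continuity of the
norms, and this set is `h`-invariant. By minimality it is `X` or empty. If it is `X`, all fibers of
`J` vanish and `J = 0`. If it is empty, `J` is dense in each simple fiber, and a partition of unity
glues local approximations of `1`, so `1 ∈ J` and `I` is everything
(`CXAlgebra.eq_bot_or_eq_top_of_invariant`).

Suppose `J = 0`. Since `X` is infinite, `h` has no periodic points. Hence a cutoff `k` supported
near a point satisfies `k (∑ aₙ uⁿ) k = k² a₀`. As `A` meets `I` trivially, elements of `I` cannot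
lower norms of elements of `A`, so `‖a₀‖ ≤ ‖∑ aₙ uⁿ + b‖` for `b ∈ I`
(`norm_apply_zero_le_norm_laurentSum_add`). Thus zeroth coefficients vanish on `I`. They are
averages over the circle `U ↦ zU` of vector functionals, and these averages are faithful on the full
crossed product: for `b ∈ I` the average of `b* b` is zero, which forces `b = 0`.

The crossed product is nonzero because an invariant state, found by Hahn-Banach, yields a covariant
GNS representation. -/

section

open Topology Filter

/-! ### Central convex combinations -/

section ConvexCombination

/-- A convex combination with central coefficients does not increase the maximum of the norms. -/
theorem CStarAlgebra.norm_sum_star_mul_self_mul_le {A ι : Type*} [CStarAlgebra A] [Fintype ι]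
    {s y : ι → A} {ε : ℝ} (hε : 0 ≤ ε) (hs : ∀ i a, Commute (s i) a)
    (hs' : ∀ i a, Commute (star (s i)) a)
    (h1 : ∑ i, star (s i) * s i = 1) (hy : ∀ i, ‖y i‖ ≤ ε) :
    ‖∑ i, star (s i) * s i * y i‖ ≤ ε := by
  let _ := CStarAlgebra.spectralOrder A
  let _ := CStarAlgebra.spectralOrderedRing A
  set z := ∑ i, star (s i) * s i * y i with hz
  have hcomm : ∀ i a b, star (s i * a) * (s i * b) = star (s i) * s i * (star a * b) := by
    intro i a b
    rw [star_mul, (hs' i (star a)).eq.symm, mul_assoc, mul_assoc, ← mul_assoc (star a),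
      ← (hs i (star a)).eq, mul_assoc]
  have key : 0 ≤ ∑ i, star (s i * (y i - z)) * (s i * (y i - z)) :=
    Finset.sum_nonneg fun i _ => star_mul_self_nonneg _
  have hzstar : star z = ∑ i, star (s i) * s i * star (y i) := by
    rw [hz, star_sum]
    refine Finset.sum_congr rfl fun i _ => ?_
    rw [star_mul, star_mul, star_star, ← mul_assoc, ← (hs' i (star (y i))).eq,
      mul_assoc (star (s i)), ← (hs i (star (y i))).eq, mul_assoc]
  have e1 : ∑ i, star (s i * (y i - z)) * (s i * (y i - z))
      = ∑ i, star (s i) * s i * (star (y i) * y i) - star z * z := by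
    have : ∀ i, star (s i * (y i - z)) * (s i * (y i - z))
        = star (s i) * s i * (star (y i) * y i) - (star (s i) * s i * star (y i)) * z
          - star z * (star (s i) * s i * y i) + star (s i) * s i * (star z * z) := by
      intro i
      have hc : star z * (star (s i) * s i * y i) = star (s i) * s i * (star z * y i) := by
        rw [← mul_assoc, ← mul_assoc, ← (hs' i (star z)).eq, mul_assoc (star (s i)),
          ← (hs i (star z)).eq]
        simp only [mul_assoc]
      rw [hcomm, hc, star_sub]
      noncomm_ring
    simp only [this, Finset.sum_add_distrib, Finset.sum_sub_distrib, ← Finset.sum_mul,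
      ← Finset.mul_sum, h1, ← hzstar, ← hz]
    noncomm_ring
  rw [e1, sub_nonneg] at key
  have e2 : ∑ i, star (s i) * s i * (star (y i) * y i) ≤ algebraMap ℝ A (ε ^ 2) := by
    calc _ ≤ ∑ i, algebraMap ℝ A (ε ^ 2) * (star (s i) * s i) := by
          refine Finset.sum_le_sum fun i _ => ?_
          have h2 : star (y i) * y i ≤ algebraMap ℝ A (ε ^ 2) :=
            CStarAlgebra.star_mul_le_algebraMap_norm_sq.trans
              (algebraMap_mono A (pow_le_pow_left₀ (norm_nonneg _) (hy i) 2))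
          have h3 := star_left_conjugate_le_conjugate h2 (s i)
          calc _ = star (s i) * (star (y i) * y i) * s i := by
                rw [mul_assoc, (hs i _).eq, ← mul_assoc]
            _ ≤ _ := h3
            _ = _ := by rw [mul_assoc, ← mul_assoc, ← Algebra.commutes, mul_assoc]
      _ = _ := by rw [← Finset.mul_sum, h1, mul_one]
  have e3 : ‖star z * z‖ ≤ ε ^ 2 :=
    (CStarAlgebra.norm_le_iff_le_algebraMap _ (by positivity) (star_mul_self_nonneg z)).2
      (key.trans e2)
  rw [CStarRing.norm_star_mul_self, ← sq] at e3
  exact le_of_sq_le_sq e3 hε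

end ConvexCombination

/-! ### Local-to-global arguments over `X` and invariant ideals -/

namespace CXAlgebra

variable {X A : Type*} [TopologicalSpace X] [CompactSpace X] [CStarAlgebra A]
  (S : CXAlgebra X A)

theorem norm_eta_le (f : C(X, ℂ)) : ‖S.η f‖ ≤ ‖f‖ :=
  NonUnitalStarAlgHom.norm_apply_le S.η f

/-- Gluing: a partition of unity is subordinate to the sets where the cutoffs `k` equal `1`, so each
`y i` may be replaced by its cut-off version. The convexity estimate keeps the bound `ε` whatever
the number of pieces. -/
theorem exists_partition [T2Space X] {ε : ℝ} (hε : 0 ≤ ε) (y : X → A)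
    (H : ∀ x, ∃ k : C(X, ℂ), (∀ᶠ z in 𝓝 x, k z = 1) ∧ ‖S.η k * y x‖ ≤ ε) :
    ∃ (t : Finset X) (g : t → C(X, ℂ)), ∑ i, S.η (g i) = 1 ∧ ‖∑ i, S.η (g i) * y i‖ ≤ ε := by
  choose k hk hky using H
  obtain ⟨t, -, ht⟩ := isCompact_univ.elim_nhds_subcover (fun x => interior {z | k x z = 1})
    (fun x _ => isOpen_interior.mem_nhds (mem_interior_iff_mem_nhds.2 (hk x)))
  obtain ⟨p, hp⟩ := PartitionOfUnity.exists_isSubordinate (s := Set.univ) isClosed_univ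
    (fun i : t => interior {z | k i z = 1}) (fun _ => isOpen_interior)
    (by intro x hx; simpa using ht hx)
  -- Square roots put the weights in the form `star r * r` required by the convexity estimate.
  let r : t → C(X, ℂ) := fun i =>
    ⟨fun x => ((√(p i x) : ℝ) : ℂ), Complex.continuous_ofReal.comp (by fun_prop)⟩
  let g : t → C(X, ℂ) := fun i => star (r i) * r i
  have hg : ∀ i x, g i x = (p i x : ℂ) := by
    intro i x
    have : √(p i x) * √(p i x) = p i x := Real.mul_self_sqrt (p.nonneg i x)
    simp only [g, r, ContinuousMap.mul_apply, ContinuousMap.star_apply, ContinuousMap.coe_mk,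
      RCLike.star_def, Complex.conj_ofReal]
    exact_mod_cast this
  have hgsum : ∑ i, g i = 1 := by
    ext x
    have : ∑ i, p i x = 1 := by
      have := p.sum_eq_one (Set.mem_univ x)
      rwa [finsum_eq_sum_of_fintype] at this
    rw [ContinuousMap.sum_apply]
    simp only [hg, ContinuousMap.one_apply]
    exact_mod_cast this
  have hgk : ∀ i, g i * k i = g i := by
    intro i
    ext x
    rw [ContinuousMap.mul_apply]
    by_cases hx : p i x = 0
    · simp [hg, hx]
    · have : x ∈ interior {z | k i z = 1} := hp i (subset_tsupport _ hx)
      have : x ∈ {z | k i z = 1} := interior_subset this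
      have : k i x = 1 := this
      rw [this, mul_one]
  refine ⟨t, g, by rw [← map_sum, hgsum, map_one], ?_⟩
  have := CStarAlgebra.norm_sum_star_mul_self_mul_le (s := fun i => S.η (r i))
    (y := fun i : t => S.η (k i) * y i) hε (fun i a => S.central _ a)
    (fun i a => by rw [← map_star]; exact S.central _ a)
    (by simp only [← map_star, ← map_mul]; rw [← map_sum, hgsum, map_one]) (fun i => hky i)
  have e : ∀ i : t, star (S.η (r i)) * S.η (r i) * (S.η (k i) * y i) = S.η (g i) * y i := by
    intro i
    rw [← map_star, ← map_mul, ← mul_assoc, ← map_mul]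
    exact congrArg (fun f => S.η f * y i) (hgk i)
  simpa only [e] using this

theorem exists_cutoff [T2Space X] {x : X} {V : Set X} (hV : V ∈ 𝓝 x) :
    ∃ k : C(X, ℂ), (∀ᶠ z in 𝓝 x, k z = 1) ∧ (∀ z, ‖k z‖ ≤ 1) ∧ ∀ z ∉ V, k z = 0 := by
  obtain ⟨W, hW, hWc, hWV⟩ := exists_mem_nhds_isClosed_subset (interior_mem_nhds.2 hV)
  obtain ⟨f, hf0, hf1, hf⟩ := exists_continuous_zero_one_of_isClosed
    (isOpen_interior (s := V)).isClosed_compl hWc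
    (Set.disjoint_left.2 fun z hz hz' => hz (hWV hz'))
  refine ⟨⟨fun z => (f z : ℂ), by fun_prop⟩, ?_, ?_, ?_⟩
  · filter_upwards [hW] with z hz
    simp [hf1 hz]
  · intro z
    have := hf z
    simp only [ContinuousMap.coe_mk, Complex.norm_real, Real.norm_eq_abs]
    rw [abs_of_nonneg this.1]; exact this.2
  · intro z hz
    have : f z = 0 := hf0 fun h => hz (interior_subset h)
    simp [this]

/-- A generator `η f * a` is made small by a cutoff supported where `f` is small. The bound `‖k z‖ ≤
1` is carried along so that the product of two cutoffs serves for a sum. -/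
theorem exists_norm_eta_mul_le_of_mem_span [T2Space X] {x : X} {c : A}
    (hc : c ∈ Ideal.span {b : A | ∃ f : C(X, ℂ), ∃ a : A, f x = 0 ∧ b = S.η f * a}) :
    ∀ δ > 0, ∃ k : C(X, ℂ), (∀ᶠ z in 𝓝 x, k z = 1) ∧ (∀ z, ‖k z‖ ≤ 1) ∧ ‖S.η k * c‖ ≤ δ := by
  induction hc using Submodule.span_induction with
  | mem c hc =>
    obtain ⟨f, a, hf, rfl⟩ := hc
    intro δ hδ
    have hδ' : 0 < δ / (‖a‖ + 1) := by positivity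
    have : {z | ‖f z‖ < δ / (‖a‖ + 1)} ∈ 𝓝 x :=
      (isOpen_lt (by fun_prop) continuous_const).mem_nhds (by simpa [hf] using hδ')
    obtain ⟨k, hk1, hk, hk0⟩ := exists_cutoff this
    refine ⟨k, hk1, hk, ?_⟩
    have hkf : ‖k * f‖ ≤ δ / (‖a‖ + 1) := by
      refine (ContinuousMap.norm_le _ hδ'.le).2 fun z => ?_
      rw [ContinuousMap.mul_apply, norm_mul]
      by_cases hz : ‖f z‖ < δ / (‖a‖ + 1)
      · exact (mul_le_of_le_one_left (norm_nonneg _) (hk z)).trans hz.le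
      · rw [hk0 z hz]; simpa using hδ'.le
    rw [← mul_assoc, ← map_mul]
    calc _ ≤ ‖S.η (k * f)‖ * ‖a‖ := norm_mul_le _ _
      _ ≤ δ / (‖a‖ + 1) * (‖a‖ + 1) := by
        gcongr
        · exact (S.norm_eta_le _).trans hkf
        · linarith
      _ = δ := by field_simp
  | zero => exact fun δ hδ => ⟨1, by simp, by simp, by simpa using hδ.le⟩
  | add y z _ _ hy hz =>
    intro δ hδ
    obtain ⟨k, hk1, hk, hky⟩ := hy (δ / 2) (by positivity)
    obtain ⟨l, hl1, hl, hlz⟩ := hz (δ / 2) (by positivity)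
    have hle : ∀ f : C(X, ℂ), (∀ z, ‖f z‖ ≤ 1) → ‖S.η f‖ ≤ 1 := fun f hf =>
      (S.norm_eta_le f).trans ((ContinuousMap.norm_le _ zero_le_one).2 hf)
    refine ⟨k * l, ?_, fun z => ?_, ?_⟩
    · filter_upwards [hk1, hl1] with w h1 h2
      simp [h1, h2]
    · rw [ContinuousMap.mul_apply, norm_mul]
      exact mul_le_one₀ (hk z) (norm_nonneg _) (hl z)
    · rw [map_mul, mul_add]
      calc _ ≤ ‖S.η l * (S.η k * y)‖ + ‖S.η k * (S.η l * z)‖ := by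
            rw [← mul_assoc, ← mul_assoc, (S.central l (S.η k)).eq]; exact norm_add_le _ _
        _ ≤ 1 * (δ / 2) + 1 * (δ / 2) := by
            refine add_le_add ((norm_mul_le _ _).trans ?_) ((norm_mul_le _ _).trans ?_)
            · exact mul_le_mul (hle l hl) hky (norm_nonneg _) zero_le_one
            · exact mul_le_mul (hle k hk) hlz (norm_nonneg _) zero_le_one
        _ = δ := by ring
  | smul r y _ hy =>
    intro δ hδ
    obtain ⟨k, hk1, hk, hky⟩ := hy (δ / (‖r‖ + 1)) (by positivity)
    refine ⟨k, hk1, hk, ?_⟩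
    rw [smul_eq_mul, ← mul_assoc, (S.central k r).eq, mul_assoc]
    calc _ ≤ ‖r‖ * ‖S.η k * y‖ := norm_mul_le _ _
      _ ≤ (‖r‖ + 1) * (δ / (‖r‖ + 1)) := by gcongr; linarith
      _ = δ := by field_simp

/-- If `‖y(x)‖ < ε` then `y` is small near `x`. -/
theorem exists_norm_eta_mul_le [T2Space X] {x : X} {y c : A} {ε : ℝ}
    (hc : c ∈ S.fiberIdeal x) (h : ‖y - c‖ < ε) :
    ∃ k : C(X, ℂ), (∀ᶠ z in 𝓝 x, k z = 1) ∧ ‖S.η k * y‖ ≤ ε := by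
  set δ := (ε - ‖y - c‖) / 2 with hδ
  have hδ0 : 0 < δ := by rw [hδ]; linarith
  obtain ⟨d, hd, hcd⟩ := Metric.mem_closure_iff.1 (show c ∈ closure (_ : Set A) from hc) δ hδ0
  obtain ⟨k, hk1, hk, hkd⟩ := S.exists_norm_eta_mul_le_of_mem_span hd δ hδ0
  refine ⟨k, hk1, ?_⟩
  have hle : ‖S.η k‖ ≤ 1 := (S.norm_eta_le k).trans ((ContinuousMap.norm_le _ zero_le_one).2 hk)
  rw [dist_eq_norm] at hcd
  calc ‖S.η k * y‖ = ‖S.η k * ((y - c) + (c - d)) + S.η k * d‖ := by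
        rw [← mul_add]; congr 2; abel
    _ ≤ ‖S.η k * ((y - c) + (c - d))‖ + ‖S.η k * d‖ := norm_add_le _ _
    _ ≤ 1 * (‖y - c‖ + δ) + δ := by
        refine add_le_add ((norm_mul_le _ _).trans ?_) hkd
        exact mul_le_mul hle ((norm_add_le _ _).trans (by gcongr)) (norm_nonneg _) zero_le_one
    _ = ε := by rw [hδ]; ring

/-- Membership in a closed ideal can be checked fiberwise. -/
theorem mem_of_forall_approx [T2Space X] {J : Ideal A} (hJ : IsClosed (J : Set A)) {a : A}
    (H : ∀ x, ∀ ε > 0, ∃ j ∈ J, ∃ c ∈ S.fiberIdeal x, ‖a - j - c‖ < ε) : a ∈ J := by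
  refine hJ.closure_subset (Metric.mem_closure_iff.2 fun ε hε => ?_)
  choose j hj c hc hjc using fun x => H x (ε / 2) (by positivity)
  obtain ⟨t, g, hg1, hg⟩ := S.exists_partition (ε := ε / 2) (by positivity) (fun x => a - j x)
    (fun x => S.exists_norm_eta_mul_le (hc x) (hjc x))
  refine ⟨∑ i, S.η (g i) * j i, Ideal.sum_mem _ fun i _ => J.mul_mem_left _ (hj i), ?_⟩
  simp only [mul_sub, Finset.sum_sub_distrib, ← Finset.sum_mul, hg1, one_mul] at hg
  rw [dist_eq_norm]
  linarith

theorem eval_eq_zero_iff {x : X} {a : A} : S.eval x a = 0 ↔ a ∈ S.fiberIdeal x :=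
  Ideal.Quotient.eq_zero_iff_mem

theorem map_mem_fiberIdeal {α : A ≃⋆ₐ[ℂ] A} {h : X ≃ₜ X} (hα : S.LiesOver α h) {x : X} {a : A}
    (ha : a ∈ S.fiberIdeal x) : α a ∈ S.fiberIdeal (h x) := by
  have hcont : Continuous α := (NonUnitalStarAlgHom.isometry α α.injective).continuous
  refine map_mem_closure hcont ha fun c hc => ?_
  change α c ∈ Ideal.span _
  change c ∈ Ideal.span _ at hc
  induction hc using Submodule.span_induction with
  | mem c hc =>
    obtain ⟨f, a, hf, rfl⟩ := hc
    exact Ideal.subset_span ⟨f.comp (h.symm : C(X, X)), α a, by simpa using hf,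
      by rw [map_mul, hα f]⟩
  | zero => simp
  | add y z _ _ hy hz => rw [map_add]; exact Ideal.add_mem _ hy hz
  | smul r y _ hy => rw [smul_eq_mul, map_mul]; exact Ideal.mul_mem_left _ _ hy

theorem liesOver_symm {α : A ≃⋆ₐ[ℂ] A} {h : X ≃ₜ X} (hα : S.LiesOver α h) :
    S.LiesOver α.symm h.symm := by
  intro f
  rw [StarAlgEquiv.symm_apply_eq, hα]
  congr 1
  ext x
  simp

theorem map_mem_fiberIdeal_iff {α : A ≃⋆ₐ[ℂ] A} {h : X ≃ₜ X} (hα : S.LiesOver α h) {x : X}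
    {a : A} : α a ∈ S.fiberIdeal (h x) ↔ a ∈ S.fiberIdeal x := by
  refine ⟨fun ha => ?_, S.map_mem_fiberIdeal hα⟩
  simpa using S.map_mem_fiberIdeal (S.liesOver_symm hα) ha

/-- In a simple fiber, a non-vanishing ideal has dense image. -/
theorem exists_approx_of_fiber_simple {x : X} (hx : IsTopologicallySimple (S.Fiber x))
    (J : Ideal A) [J.IsTwoSided] {j : A} (hj : j ∈ J) (hjx : S.eval x j ≠ 0) (a : A)
    {ε : ℝ} (hε : 0 < ε) : ∃ i ∈ J, ∃ c ∈ S.fiberIdeal x, ‖a - i - c‖ < ε := by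
  have hq : IsQuotientMap (S.eval x) := isQuotientMap_quotient_mk'
  have hsurj : Function.Surjective (S.eval x) := Ideal.Quotient.mk_surjective
  -- `K` contains the kernel of `S.eval x`, so it is a union of cosets; its image in the fiber is
  -- therefore closed, and membership in the image pulls back to `K`.
  let K : Ideal A := (J ⊔ S.fiberIdeal x).closure
  have hJK : ∀ i ∈ J, i ∈ K := fun i hi => subset_closure (Ideal.mem_sup_left hi)
  have hKer : ∀ a b, a ∈ K → S.eval x a = S.eval x b → b ∈ K := by
    intro a b ha hab
    have : b - a ∈ K := subset_closure (Ideal.mem_sup_right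
      (S.eval_eq_zero_iff.1 (by rw [map_sub, hab, sub_self])))
    simpa using K.add_mem this ha
  have hK : ∀ b ∈ K, ∀ c, b * c ∈ K := by
    intro b hb c
    refine map_mem_closure (f := fun b => b * c) (by fun_prop) hb fun d hd => ?_
    obtain ⟨i, hi, e, he, rfl⟩ := Submodule.mem_sup.1 hd
    change (i + e) * c ∈ J ⊔ S.fiberIdeal x
    rw [add_mul]
    exact Submodule.add_mem_sup (J.mul_mem_right c hi) ((S.fiberIdeal x).mul_mem_right c he)
  let L : TwoSidedIdeal (S.Fiber x) := TwoSidedIdeal.mk' (S.eval x '' (K : Set A))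
    ⟨0, K.zero_mem, map_zero _⟩
    (by rintro _ _ ⟨a, ha, rfl⟩ ⟨b, hb, rfl⟩; exact ⟨a + b, K.add_mem ha hb, map_add _ _ _⟩)
    (by rintro _ ⟨a, ha, rfl⟩; exact ⟨-a, K.neg_mem ha, map_neg _ _⟩)
    (by
      rintro c _ ⟨a, ha, rfl⟩
      obtain ⟨c, rfl⟩ := hsurj c
      exact ⟨c * a, K.mul_mem_left c ha, map_mul _ _ _⟩)
    (by
      rintro _ c ⟨a, ha, rfl⟩
      obtain ⟨c, rfl⟩ := hsurj c
      exact ⟨a * c, hK a ha c, map_mul _ _ _⟩)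
  have hL : (L : Set (S.Fiber x)) = S.eval x '' (K : Set A) := TwoSidedIdeal.coe_mk' ..
  have htop : L = ⊤ := by
    refine (hx.2 L ?_).resolve_left fun hbot => hjx ?_
    · rw [hL, ← hq.isClosed_preimage]
      convert (isClosed_closure : IsClosed (K : Set A)) using 1
      ext b
      refine ⟨?_, fun hb => ⟨b, hb, rfl⟩⟩
      rintro ⟨a, ha, hab⟩
      exact hKer a b ha hab
    · have : S.eval x j ∈ (L : Set (S.Fiber x)) := hL ▸ ⟨j, hJK j hj, rfl⟩
      rwa [hbot] at this
  have ha : a ∈ K := by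
    have : S.eval x a ∈ (L : Set (S.Fiber x)) := by rw [htop]; trivial
    rw [hL] at this
    obtain ⟨b, hb, hab⟩ := this
    exact hKer b a hb hab
  obtain ⟨d, hd, hdist⟩ := Metric.mem_closure_iff.1 (show a ∈ closure (_ : Set A) from ha) ε hε
  obtain ⟨i, hi, c, hc, rfl⟩ := Submodule.mem_sup.1 hd
  exact ⟨i, hi, c, hc, by rwa [dist_eq_norm, ← sub_sub] at hdist⟩

/-- A continuous `C(X)`-algebra with simple fibers has no proper closed invariant ideals
over a minimal homeomorphism. -/
theorem eq_bot_or_eq_top_of_invariant [T2Space X] (hcont : S.IsContinuous)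
    (hfib : ∀ x : X, IsTopologicallySimple (S.Fiber x)) {h : X ≃ₜ X} (hmin : IsMinimalHomeo h)
    {α : A ≃⋆ₐ[ℂ] A} (hα : S.LiesOver α h) (J : Ideal A) [J.IsTwoSided]
    (hJ : IsClosed (J : Set A)) (hinv : ∀ a, α a ∈ J ↔ a ∈ J) : J = ⊥ ∨ J = ⊤ := by
  let F : Set X := {x | ∀ a ∈ J, a ∈ S.fiberIdeal x}
  have hF : F = ⋂ a ∈ J, {x | ‖S.eval x a‖ = 0} := by
    ext x
    simp only [F, Set.mem_ofPred_eq, Set.mem_iInter]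
    refine forall₂_congr fun a _ => ?_
    rw [← S.eval_eq_zero_iff, norm_eq_zero]
  have hFc : IsClosed F := by
    rw [hF]
    exact isClosed_biInter fun a _ => isClosed_eq (hcont a) continuous_const
  have hiff : ∀ x, h x ∈ F ↔ x ∈ F := by
    intro x
    refine ⟨fun hx a ha => (S.map_mem_fiberIdeal_iff hα).1 (hx _ ((hinv a).2 ha)),
      fun hx a ha => ?_⟩
    have h1 : α.symm a ∈ J := (hinv _).1 (by simpa using ha)
    simpa using (S.map_mem_fiberIdeal_iff hα).2 (hx _ h1)
  have himage : h '' F = F := by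
    ext x
    obtain ⟨x, rfl⟩ := h.surjective x
    rw [h.injective.mem_set_image, hiff]
  rcases hmin F hFc himage with hE | hU
  · right
    rw [Ideal.eq_top_iff_one]
    refine S.mem_of_forall_approx hJ fun x ε hε => ?_
    have hx : x ∉ F := by simp [hE]
    simp only [F, Set.mem_ofPred_eq, not_forall] at hx
    obtain ⟨j, hj, hjx⟩ := hx
    exact S.exists_approx_of_fiber_simple (hfib x) J hj (by rwa [Ne, S.eval_eq_zero_iff]) 1 hε
  · left
    rw [eq_bot_iff]
    intro a ha
    -- The fiberwise criterion for the zero ideal: an element vanishing in every fiber is zero.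
    refine S.mem_of_forall_approx isClosed_singleton fun x ε hε => ⟨0, rfl, a, ?_, by simpa⟩
    have hx : x ∈ F := by simp [hU]
    exact hx a ha

end CXAlgebra

/-- A minimal homeomorphism of an infinite compact space has no periodic points. -/
theorem IsMinimalHomeo.zpow_apply_ne {X : Type*} [TopologicalSpace X] [T1Space X] [Infinite X]
    {h : X ≃ₜ X} (hmin : IsMinimalHomeo h) {n : ℤ} (hn : n ≠ 0) (x : X) : (h ^ n) x ≠ x := by
  intro hx
  have hper : ∀ m : ℤ, (h ^ (m % n)) x = (h ^ m) x := by
    intro m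
    conv_rhs => rw [← Int.emod_add_mul_ediv m n, zpow_add, zpow_mul]
    have : ∀ k : ℤ, ((h ^ n) ^ k) x = x := by
      intro k
      let T : Subgroup (X ≃ₜ X) :=
        { carrier := {g | g x = x}
          one_mem' := rfl
          mul_mem' := fun {f g} hf hg => by
            change f (g x) = x
            rw [show g x = x from hg]; exact hf
          inv_mem' := fun {f} hf => f.symm_apply_eq.2 (show f x = x from hf).symm }
      exact T.zpow_mem (show h ^ n ∈ T from hx) k
    change _ = (h ^ (m % n)) (((h ^ n) ^ (m / n)) x)
    rw [this]
  -- The orbit of a periodic point is finite, hence closed, and it is invariant; minimality would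
  -- make `X` finite.
  let O : Set X := Set.range fun m : ℤ => (h ^ m) x
  have hO : O.Finite := by
    refine ((Set.finite_Ico (0 : ℤ) |n|).image fun m => (h ^ m) x).subset ?_
    rintro _ ⟨m, rfl⟩
    exact ⟨m % n, ⟨Int.emod_nonneg _ hn, Int.emod_lt_abs _ hn⟩, hper m⟩
  have himage : h '' O = O := by
    have hs : ∀ m : ℤ, h ((h ^ m) x) = (h ^ (m + 1)) x := by
      intro m
      rw [add_comm, zpow_add, zpow_one]; rfl
    apply Set.Subset.antisymm
    · rintro _ ⟨_, ⟨m, rfl⟩, rfl⟩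
      exact ⟨m + 1, (hs m).symm⟩
    · rintro _ ⟨m, rfl⟩
      exact ⟨_, ⟨m - 1, rfl⟩, by rw [hs]; simp⟩
  rcases hmin O hO.isClosed himage with h0 | h1
  · exact Set.range_nonempty _ |>.ne_empty h0
  · exact Set.infinite_univ (h1 ▸ hO)

end

/-! ### Norms modulo an ideal that meets `A` trivially -/

section

/-- An injective `*`-homomorphism modulo a two-sided ideal does not decrease norms. -/
theorem TwoSidedIdeal.norm_le_norm_add_of_nonneg {A B : Type*} [CStarAlgebra A] [PartialOrder A]
    [StarOrderedRing A] [NormedRing B] [CompleteSpace B] [Algebra ℂ B] [StarRing B]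
    (φ : A →⋆ₐ[ℂ] B) (I : TwoSidedIdeal B) (hI : ∀ a, φ a ∈ I → a = 0)
    (hφ : ∀ a, ‖φ a‖ ≤ ‖a‖) {a : A} (ha : 0 ≤ a) {c : B} (hc : c ∈ I) : ‖a‖ ≤ ‖φ a + c‖ := by
  by_contra! hlt
  have : Nontrivial A := ⟨⟨a, 0, by rintro rfl; simp at hlt; exact absurd hlt (norm_nonneg _).not_gt⟩⟩
  obtain ⟨s, hs1, hs2⟩ := exists_between hlt
  have hs0 : 0 < s := (norm_nonneg _).trans_lt hs1
  have hsa : IsSelfAdjoint a := .of_nonneg ha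
  -- `g` is the part of `a` above the level `s`, nonzero as `s < ‖a‖`, and `g = g * a * m` where `m`
  -- inverts `a` there. Modulo `I` this reads `φ g = φ g * x` with `‖x‖ < 1`; since `1 - x` is
  -- invertible, `φ g ∈ I`, a contradiction. No C*-structure on the quotient is needed.
  set g : A := cfc (fun t : ℝ => max (t - s) 0) a with hg
  set m : A := cfc (fun t : ℝ => (max t s)⁻¹) a with hm
  have hcm : ContinuousOn (fun t : ℝ => (max t s)⁻¹) (spectrum ℝ a) :=
    ContinuousOn.inv₀ (by fun_prop) fun t _ => (hs0.trans_le (le_max_right t s)).ne'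
  have hgam : g = g * a * m := by
    conv_rhs => rw [hg, hm]; enter [1, 2]; rw [← cfc_id' ℝ a]
    rw [← cfc_mul .., ← cfc_mul ..]
    refine cfc_congr fun t _ => ?_
    rcases le_total t s with h | h
    · simp [h]
    · have : t ≠ 0 := (hs0.trans_le h).ne'
      simp only [max_eq_left h]
      field_simp
  have hmn : ‖m‖ ≤ s⁻¹ := by
    refine norm_cfc_le (by positivity) fun t _ => ?_
    rw [norm_inv, Real.norm_of_nonneg (hs0.le.trans (le_max_right t s))]
    exact inv_anti₀ hs0 (le_max_right t s)
  have hg0 : g ≠ 0 := by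
    have hmem : ‖a‖ ∈ spectrum ℝ a := CStarAlgebra.norm_mem_spectrum_of_nonneg ha
    have h1 : ‖(fun t : ℝ => max (t - s) 0) ‖a‖‖ ≤ ‖g‖ :=
      norm_apply_le_norm_cfc (fun t : ℝ => max (t - s) 0) a hmem
    rw [← norm_pos_iff]
    refine lt_of_lt_of_le ?_ h1
    rw [norm_pos_iff]
    simp only [ne_eq, max_eq_right_iff, not_le]
    linarith
  apply hg0
  apply hI
  set x := (φ a + c) * φ m with hx
  have hx1 : ‖x‖ < 1 := by
    calc ‖x‖ ≤ ‖φ a + c‖ * ‖φ m‖ := norm_mul_le _ _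
      _ ≤ ‖φ a + c‖ * s⁻¹ := by gcongr; exact (hφ m).trans hmn
      _ < s * s⁻¹ := by gcongr
      _ = 1 := mul_inv_cancel₀ hs0.ne'
  have hmem : φ g * (1 - x) ∈ I := by
    have : φ g * (1 - x) = -(φ g * c * φ m) := by
      have h2 : φ g = φ g * φ a * φ m := by rw [← map_mul, ← map_mul, ← hgam]
      rw [hx, mul_sub, mul_one, ← mul_assoc, mul_add, add_mul, ← h2]
      abel
    rw [this]
    exact I.neg_mem (I.mul_mem_right _ _ (I.mul_mem_left _ _ hc))
  have h3 := I.mul_mem_right _ (Units.oneSub x hx1)⁻¹.val hmem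
  rwa [mul_assoc, ← Units.val_oneSub x hx1, Units.mul_inv, mul_one] at h3

/-- The C*-identity reduces this to the positive element `star a * a`, perturbed by `star (φ a) * c
∈ I`; one factor `‖a‖` then cancels. -/
theorem TwoSidedIdeal.norm_le_norm_add {A B : Type*} [CStarAlgebra A] [CStarAlgebra B]
    (φ : A →⋆ₐ[ℂ] B) (I : TwoSidedIdeal B) (hI : ∀ a, φ a ∈ I → a = 0) (a : A) {c : B}
    (hc : c ∈ I) : ‖a‖ ≤ ‖φ a + c‖ := by
  let _ := CStarAlgebra.spectralOrder A
  let _ := CStarAlgebra.spectralOrderedRing A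
  have hφ : ∀ a, ‖φ a‖ ≤ ‖a‖ := fun a => NonUnitalStarAlgHom.norm_apply_le φ a
  have h := TwoSidedIdeal.norm_le_norm_add_of_nonneg φ I hI hφ (star_mul_self_nonneg a)
    (I.mul_mem_left (star (φ a)) c hc)
  rw [map_mul, map_star, ← mul_add, CStarRing.norm_star_mul_self] at h
  have h2 : ‖a‖ * ‖a‖ ≤ ‖a‖ * ‖φ a + c‖ := by
    refine (h.trans (norm_mul_le _ _)).trans ?_
    rw [norm_star]
    gcongr
    exact hφ a
  rcases (norm_nonneg a).eq_or_lt with h0 | h0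
  · rw [← h0]; exact norm_nonneg _
  · exact le_of_mul_le_mul_left h2 h0

end

/-! ### Finite sums `∑ aₙ uⁿ` and their zeroth coefficient -/

section

open Topology Filter

/-- The pairs `(α, h)` with this property form a subgroup, which covers negative powers as well. -/
theorem CXAlgebra.liesOver_zpow {X A : Type*} [TopologicalSpace X] [CompactSpace X]
    [CStarAlgebra A] (S : CXAlgebra X A) {α : A ≃⋆ₐ[ℂ] A} {h : X ≃ₜ X} (hα : S.LiesOver α h)
    (n : ℤ) : S.LiesOver (α ^ n) (h ^ n) := by
  let T : Subgroup ((A ≃⋆ₐ[ℂ] A) × (X ≃ₜ X)) :=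
    { carrier := {p | S.LiesOver p.1 p.2}
      one_mem' := fun f => rfl
      mul_mem' := fun {p q} hp hq f => by
        change p.1 (q.1 (S.η f)) = _
        rw [hq, hp]
        rfl
      inv_mem' := fun hp => S.liesOver_symm hp }
  exact T.zpow_mem (x := (α, h)) hα n

section LaurentSum

variable {A B : Type*} [CStarAlgebra A] [CStarAlgebra B]

/-- The finite sum `∑ c(aₙ) uⁿ`. -/
noncomputable def laurentSum (c : A →⋆ₐ[ℂ] B) (u : unitary B) : (ℤ →₀ A) →+ B :=
  Finsupp.liftAddHom fun n =>
    (AddMonoidHom.mulRight ((u ^ n : unitary B) : B)).comp (c : A →+* B).toAddMonoidHom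

variable (c : A →⋆ₐ[ℂ] B) (u : unitary B)

theorem laurentSum_apply (f : ℤ →₀ A) :
    laurentSum c u f = ∑ n ∈ f.support, c (f n) * ((u ^ n : unitary B) : B) := rfl

@[simp]
theorem laurentSum_single (n : ℤ) (a : A) :
    laurentSum c u (Finsupp.single n a) = c a * ((u ^ n : unitary B) : B) := by
  simp [laurentSum]

theorem map_laurentSum {C : Type*} [CStarAlgebra C] (φ : B →⋆ₐ[ℂ] C) {d : A →⋆ₐ[ℂ] C}
    {v : unitary C} (hd : ∀ a, φ (c a) = d a) (hv : φ u = v) (f : ℤ →₀ A) :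
    φ (laurentSum c u f) = laurentSum d v f := by
  have : Unitary.map (.ofClass φ : B →⋆* C) u = v := Subtype.ext hv
  rw [laurentSum_apply, laurentSum_apply, map_sum]
  refine Finset.sum_congr rfl fun n _ => ?_
  rw [map_mul, hd, ← this, ← map_zpow]
  rfl

variable {c u} {α : A ≃⋆ₐ[ℂ] A} (hcov : ∀ a, (u : B) * c a = c (α a) * u)
include hcov

theorem zpow_mul_coeff (n : ℤ) (a : A) :
    ((u ^ n : unitary B) : B) * c a = c ((α ^ n) a) * ((u ^ n : unitary B) : B) := by
  let T : Subgroup ((A ≃⋆ₐ[ℂ] A) × unitary B) :=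
    { carrier := {p | ∀ a, (p.2 : B) * c a = c (p.1 a) * p.2}
      one_mem' := fun a => by simp
      mul_mem' := fun {p q} hp hq a => by
        change (p.2 : B) * q.2 * c a = c (p.1 (q.1 a)) * (p.2 * q.2)
        rw [mul_assoc, hq, ← mul_assoc, hp, mul_assoc]
      inv_mem' := fun {p} hp a => by
        change star (p.2 : B) * c a = c (p.1.symm a) * star (p.2 : B)
        have h := hp (p.1.symm a)
        rw [StarAlgEquiv.apply_symm_apply] at h
        calc _ = star (p.2 : B) * (c a * p.2) * star (p.2 : B) := by
              rw [mul_assoc, mul_assoc, Unitary.mul_star_self_of_mem p.2.2, mul_one]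
          _ = _ := by rw [← h, ← mul_assoc, Unitary.star_mul_self_of_mem p.2.2, one_mul] }
  exact T.zpow_mem (x := (α, u)) hcov n a

theorem mul_mem_range_laurentSum {x y : B} (hx : x ∈ (laurentSum c u).range)
    (hy : y ∈ (laurentSum c u).range) : x * y ∈ (laurentSum c u).range := by
  obtain ⟨f, rfl⟩ := hx
  obtain ⟨g, rfl⟩ := hy
  rw [laurentSum_apply, laurentSum_apply, Finset.sum_mul_sum]
  refine sum_mem fun n _ => sum_mem fun m _ => ⟨Finsupp.single (n + m) (f n * (α ^ n) (g m)), ?_⟩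
  rw [laurentSum_single, map_mul, zpow_add, Submonoid.coe_mul]
  calc _ = c (f n) * (c ((α ^ n) (g m)) * ((u ^ n : unitary B) : B)) * ((u ^ m : unitary B) : B) := by
        simp only [mul_assoc]
    _ = _ := by rw [← zpow_mul_coeff hcov]; simp only [mul_assoc]

theorem star_mem_range_laurentSum {x : B} (hx : x ∈ (laurentSum c u).range) :
    star x ∈ (laurentSum c u).range := by
  obtain ⟨f, rfl⟩ := hx
  rw [laurentSum_apply, star_sum]
  refine sum_mem fun n _ => ⟨Finsupp.single (-n) ((α ^ (-n)) (star (f n))), ?_⟩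
  rw [laurentSum_single, star_mul, ← zpow_mul_coeff hcov, map_star, zpow_neg, ← Unitary.star_eq_inv,
    Unitary.coe_star]

/-- The finite sums `∑ c(aₙ) uⁿ` form a `*`-subalgebra. -/
noncomputable def laurentSubalgebra : StarSubalgebra ℂ B where
  carrier := (laurentSum c u).range
  mul_mem' := mul_mem_range_laurentSum hcov
  add_mem' := add_mem
  algebraMap_mem' r := ⟨Finsupp.single 0 (algebraMap ℂ A r), by simp [AlgHomClass.commutes]⟩
  star_mem' := star_mem_range_laurentSum hcov

/-- A closed ideal of `B` either does not meet `A` or is everything. -/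
theorem eq_zero_of_coeff_mem_or_eq_top {X : Type*} [TopologicalSpace X] [CompactSpace X]
    [T2Space X] (S : CXAlgebra X A) (hcont : S.IsContinuous)
    (hfib : ∀ x : X, IsTopologicallySimple (S.Fiber x)) {h : X ≃ₜ X} (hmin : IsMinimalHomeo h)
    (hα : S.LiesOver α h) (I : TwoSidedIdeal B) (hI : IsClosed (I : Set B)) :
    (∀ a, c a ∈ I → a = 0) ∨ I = ⊤ := by
  let J : Ideal A :=
    { carrier := {a | c a ∈ I}
      zero_mem' := by simp [I.zero_mem]
      add_mem' := fun ha hb => by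
        simpa using I.add_mem ha hb
      smul_mem' := fun a b hb => by
        simpa using I.mul_mem_left (c a) _ hb }
  have hmem : ∀ a, a ∈ J ↔ c a ∈ I := fun a => Iff.rfl
  have : J.IsTwoSided := ⟨fun {a} b ha => by
    rw [hmem, map_mul]; exact I.mul_mem_right _ _ ha⟩
  have hJc : IsClosed (J : Set A) := by
    have : Continuous c := AddMonoidHomClass.continuous_of_bound c 1 fun a => by
      rw [one_mul]; exact NonUnitalStarAlgHom.norm_apply_le c a
    exact hI.preimage this
  have hinv : ∀ a, α a ∈ J ↔ a ∈ J := by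
    intro a
    rw [hmem, hmem]
    constructor
    · intro ha
      have e : c a = star (u : B) * (c (α a) * u) := by
        rw [← hcov, ← mul_assoc, Unitary.star_mul_self_of_mem u.2, one_mul]
      rw [e]
      exact I.mul_mem_left _ _ (I.mul_mem_right _ _ ha)
    · intro ha
      have e : c (α a) = u * c a * star (u : B) := by
        rw [hcov, mul_assoc, Unitary.mul_star_self_of_mem u.2, mul_one]
      rw [e]
      exact I.mul_mem_right _ _ (I.mul_mem_left _ _ ha)
  rcases S.eq_bot_or_eq_top_of_invariant hcont hfib hmin hα J hJc hinv with hJ | hJ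
  · left
    intro a ha
    have : a ∈ J := ha
    rwa [hJ] at this
  · right
    have h1 : (1 : A) ∈ J := by rw [hJ]; trivial
    rw [hmem, map_one] at h1
    exact I.one_mem_iff.1 h1

/-- For a free action, the zeroth coefficient is bounded modulo an ideal not meeting `A`. -/
theorem norm_apply_zero_le_norm_laurentSum_add {X : Type*} [TopologicalSpace X] [CompactSpace X]
    [T2Space X] (S : CXAlgebra X A) {h : X ≃ₜ X} (hfree : ∀ n : ℤ, n ≠ 0 → ∀ x, (h ^ n) x ≠ x)
    (hα : S.LiesOver α h) (I : TwoSidedIdeal B) (hI : ∀ a, c a ∈ I → a = 0) (f : ℤ →₀ A) {b : B}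
    (hb : b ∈ I) : ‖f 0‖ ≤ ‖laurentSum c u f + b‖ := by
  have key : ∀ x, ∃ k : C(X, ℂ), (∀ᶠ z in 𝓝 x, k z = 1) ∧
      ‖S.η k * f 0‖ ≤ ‖laurentSum c u f + b‖ := by
    intro x
    -- Freeness at `x`: for each `n ≠ 0` some neighborhood of `x` is disjoint from its translate by
    -- `h ^ n`. Only the finitely many `n` in the support of `f` are needed.
    have hsep : ∀ n : ℤ, ∃ V ∈ 𝓝 x, n ≠ 0 → ∀ w ∈ V, (h ^ n) w ∉ V := by
      intro n
      by_cases hn : n = 0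
      · exact ⟨Set.univ, univ_mem, fun h => absurd hn h⟩
      obtain ⟨P, Q, hP, hQ, hPx, hQx, hPQ⟩ := t2_separation (hfree n hn x)
      refine ⟨(h ^ n) ⁻¹' P ∩ Q, inter_mem ?_ (hQ.mem_nhds hQx), fun _ w hw hw' => ?_⟩
      · exact (h ^ n).continuous.continuousAt.preimage_mem_nhds (hP.mem_nhds hPx)
      · exact Set.disjoint_left.1 hPQ hw.1 hw'.2
    choose V hV hV' using hsep
    obtain ⟨k, hk1, hk, hk0⟩ := CXAlgebra.exists_cutoff
      ((biInter_finset_mem f.support).2 fun n _ => hV n)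
    refine ⟨k * k, ?_, ?_⟩
    · filter_upwards [hk1] with z hz
      simp [hz]
    -- Moving the right-hand cutoff past `uⁿ` turns it into `k ∘ h⁻ⁿ`, whose product with `k`
    -- vanishes for `n ≠ 0`.
    have hsum : c (S.η k) * laurentSum c u f * c (S.η k) = c (S.η (k * k) * f 0) := by
      rw [laurentSum_apply, Finset.mul_sum, Finset.sum_mul, Finset.sum_eq_single (0 : ℤ)]
      · simp only [zpow_zero, Submonoid.coe_one, mul_one]
        rw [← map_mul, ← map_mul, mul_assoc, ← (S.central k (f 0)).eq, ← mul_assoc, ← map_mul]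
      · intro n hn hn0
        have hkk : k * k.comp ((h ^ n).symm : C(X, X)) = 0 := by
          ext z
          rw [ContinuousMap.mul_apply]
          by_contra hne
          have h1 : z ∈ ⋂ n ∈ f.support, V n := by
            by_contra h'; exact hne (by rw [hk0 _ h', zero_mul]; rfl)
          have h2 : (h ^ n).symm z ∈ ⋂ n ∈ f.support, V n := by
            by_contra h'
            exact hne (by rw [ContinuousMap.comp_apply]; exact mul_eq_zero_of_right _ (hk0 _ h'))
          rw [Set.mem_iInter₂] at h1 h2
          exact hV' n hn0 _ (h2 n hn) (by simpa using h1 n hn)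
        rw [mul_assoc, mul_assoc, zpow_mul_coeff hcov, S.liesOver_zpow hα n k, ← mul_assoc,
          ← mul_assoc, ← map_mul, ← map_mul, mul_assoc, ← (S.central _ (f n)).eq, ← mul_assoc,
          ← map_mul, hkk]
        simp
      · intro h0
        simp [Finsupp.notMem_support_iff.1 h0]
    have hn : ‖c (S.η k)‖ ≤ 1 := (NonUnitalStarAlgHom.norm_apply_le c _).trans
      ((S.norm_eta_le k).trans ((ContinuousMap.norm_le _ zero_le_one).2 hk))
    calc _ ≤ ‖c (S.η (k * k) * f 0) + c (S.η k) * b * c (S.η k)‖ :=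
          TwoSidedIdeal.norm_le_norm_add c I hI _ (I.mul_mem_right _ _ (I.mul_mem_left _ _ hb))
      _ = ‖c (S.η k) * (laurentSum c u f + b) * c (S.η k)‖ := by rw [mul_add, add_mul, hsum]
      _ ≤ ‖c (S.η k)‖ * ‖laurentSum c u f + b‖ * ‖c (S.η k)‖ :=
          (norm_mul_le _ _).trans (by gcongr; exact norm_mul_le _ _)
      _ ≤ 1 * ‖laurentSum c u f + b‖ * 1 := by gcongr
      _ = _ := by ring
  obtain ⟨t, g, hg1, hg⟩ := S.exists_partition (norm_nonneg _) (fun _ => f 0) key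
  rwa [← Finset.sum_mul, hg1, one_mul] at hg

end LaurentSum

end

/-! ### Invariant states and existence of a covariant representation -/

section

open UniformSpace Completion
open scoped InnerProductSpace ComplexOrder

/-- A functional of norm at most one which is one at the unit is positive. -/
theorem ContinuousLinearMap.nonneg_of_norm_le_one {A : Type*} [CStarAlgebra A] [PartialOrder A]
    [StarOrderedRing A] (f : A →L[ℂ] ℂ) (hf : ‖f‖ ≤ 1) (h1 : f 1 = 1) {a : A} (ha : 0 ≤ a) :
    0 ≤ f a := by
  have hle : ∀ b, ‖f b‖ ≤ ‖b‖ := fun b => by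
    simpa using f.le_of_opNorm_le hf b
  have him : (f a).im = 0 := by
    by_contra hne
    have hsa : star a = a := (IsSelfAdjoint.of_nonneg ha).star_eq
    -- Evaluate `f` at `a + it`, whose squared norm is at most `‖a‖ ^ 2 + t ^ 2`. A nonzero
    -- imaginary part of `f a` would contribute a term linear in `t`, which is too large for the `t`
    -- chosen below.
    have hbound : ∀ t : ℝ, ((f a).im + t) ^ 2 ≤ ‖a‖ ^ 2 + t ^ 2 := by
      intro t
      set b := a + (Complex.I * t) • (1 : A) with hb
      have hstar : star b * b = a * a + ((t : ℂ) ^ 2) • (1 : A) := by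
        have hconj : star (Complex.I * (t : ℂ)) = -(Complex.I * t) := by simp
        have hI : -(Complex.I * (t : ℂ)) * (Complex.I * t) = (t : ℂ) ^ 2 := by
          linear_combination (-(t : ℂ) ^ 2) * Complex.I_sq
        rw [hb, star_add, star_smul, star_one, hsa, hconj, add_mul, mul_add, mul_add,
          smul_mul_smul_comm, hI, mul_smul_comm, smul_mul_assoc, one_mul, mul_one, mul_one,
          neg_smul]
        abel
      have hb2 : ‖b‖ ^ 2 ≤ ‖a‖ ^ 2 + t ^ 2 := by
        rw [sq, ← CStarRing.norm_star_mul_self, hstar]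
        refine (norm_add_le _ _).trans (add_le_add ?_ ?_)
        · rw [sq]; exact norm_mul_le _ _
        · rw [norm_smul]
          have : ‖(1 : A)‖ ≤ 1 := by
            rcases subsingleton_or_nontrivial A with h | h
            · rw [Subsingleton.elim (1 : A) 0]; simp
            · simp
          calc _ ≤ ‖((t : ℂ) ^ 2)‖ * 1 := by gcongr
            _ = _ := by simp
      have him : ((f b).im) = (f a).im + t := by simp [hb, h1]
      calc _ = |(f b).im| ^ 2 := by rw [him, sq_abs]
        _ ≤ ‖f b‖ ^ 2 := by gcongr; exact Complex.abs_im_le_norm _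
        _ ≤ ‖b‖ ^ 2 := by gcongr; exact hle b
        _ ≤ _ := hb2
    have := hbound ((‖a‖ ^ 2) / (f a).im)
    have e : ((f a).im + ‖a‖ ^ 2 / (f a).im) ^ 2
        = (f a).im ^ 2 + 2 * ‖a‖ ^ 2 + (‖a‖ ^ 2 / (f a).im) ^ 2 := by field_simp; ring
    have h0 : 0 < (f a).im ^ 2 := by positivity
    nlinarith [sq_nonneg ‖a‖]
  rw [Complex.nonneg_iff]
  refine ⟨?_, him.symm⟩
  have h2 : ‖algebraMap ℝ A ‖a‖ - a‖ ≤ ‖a‖ := by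
    rw [CStarAlgebra.norm_le_iff_le_algebraMap _ (norm_nonneg _)
      (sub_nonneg.2 (IsSelfAdjoint.of_nonneg ha).le_algebraMap_norm_self)]
    exact sub_le_self _ ha
  have h3 : f (algebraMap ℝ A ‖a‖ - a) = ‖a‖ - f a := by
    rw [map_sub, Algebra.algebraMap_eq_smul_one, ← Complex.coe_smul, map_smul, h1]
    simp
  have h4 := (Complex.re_le_norm _).trans ((hle _).trans h2)
  rw [h3] at h4
  simpa using h4

/-- An automorphism of a nonzero unital C*-algebra has an invariant state. -/
theorem exists_invariant_functional {A : Type*} [CStarAlgebra A] [Nontrivial A]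
    (α : A ≃⋆ₐ[ℂ] A) : ∃ f : A →L[ℂ] ℂ, ‖f‖ ≤ 1 ∧ f 1 = 1 ∧ ∀ a, f (α a) = f a := by
  let D : A →ₗ[ℂ] A := (α : A →⋆ₐ[ℂ] A).toAlgHom.toLinearMap - LinearMap.id
  have hD : ∀ a, D a = α a - a := fun a => rfl
  have hiso : ∀ a, ‖α a‖ = ‖a‖ := fun a => (NonUnitalStarAlgHom.norm_map α α.injective a)
  -- Summing the translates of `1 + D a` under `α ^ k`, `k < n`, telescopes to `n + (α ^ n) a - a`,
  -- of norm at least `n - 2 * ‖a‖`; dividing by `n` gives the bound in the limit.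
  have hlow : ∀ a, 1 ≤ ‖1 + D a‖ := by
    intro a
    have hiter : ∀ n : ℕ, ‖(n : ℂ) • (1 : A) + ((α ^ n) a - a)‖ ≤ n * ‖1 + D a‖ := by
      intro n
      induction n with
      | zero => simp
      | succ n ih =>
        have e : ((n + 1 : ℕ) : ℂ) • (1 : A) + ((α ^ (n + 1)) a - a)
            = α ((n : ℂ) • (1 : A) + ((α ^ n) a - a)) + (1 + D a) := by
          rw [hD, pow_succ', StarAlgEquiv.mul_apply, map_add, map_sub, map_smul, map_one]
          push_cast
          rw [add_smul, one_smul]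
          abel
        rw [e]
        refine (norm_add_le _ _).trans ?_
        rw [hiso]
        push_cast
        linarith
    have hpow : ∀ n : ℕ, ‖(α ^ n) a‖ = ‖a‖ := fun n =>
      NonUnitalStarAlgHom.norm_map (α ^ n) (α ^ n).injective a
    have hb : ∀ n : ℕ, (n : ℝ) * (1 - ‖1 + D a‖) ≤ 2 * ‖a‖ := by
      intro n
      have h1 : (n : ℝ) = ‖(n : ℂ) • (1 : A)‖ := by rw [norm_smul]; simp
      have h2 : ‖(n : ℂ) • (1 : A)‖ ≤
          ‖(n : ℂ) • (1 : A) + ((α ^ n) a - a)‖ + ‖(α ^ n) a - a‖ := by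
        simpa using norm_sub_le ((n : ℂ) • (1 : A) + ((α ^ n) a - a)) ((α ^ n) a - a)
      have h3 := norm_sub_le ((α ^ n) a) a
      rw [hpow] at h3
      have := hiter n
      rw [← h1] at h2
      linarith
    by_contra! hlt
    obtain ⟨n, hn⟩ := exists_nat_gt (2 * ‖a‖ / (1 - ‖1 + D a‖))
    rw [div_lt_iff₀ (by linarith)] at hn
    linarith [hb n]
  -- A functional is invariant iff it kills `M`. Since `1` has distance one from `M`, Hahn-Banach on
  -- `A ⧸ M` provides the state.
  let M : Submodule ℂ A := LinearMap.range D
  have hnorm : ‖(Submodule.Quotient.mk 1 : A ⧸ M)‖ = 1 := by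
    apply le_antisymm
    · exact (Submodule.Quotient.norm_mk_le M 1).trans (by simp)
    · refine le_of_forall_pos_lt_add fun ε hε => ?_
      obtain ⟨m, hm, hm'⟩ := Submodule.Quotient.norm_mk_lt (Submodule.Quotient.mk 1 : A ⧸ M) hε
      obtain ⟨a, ha⟩ := (Submodule.Quotient.eq M).1 hm
      have : m = 1 + D a := by rw [ha]; abel
      rw [this] at hm'
      exact (hlow a).trans_lt hm'
  obtain ⟨g, hg, hg1⟩ := exists_dual_vector ℂ (Submodule.Quotient.mk 1 : A ⧸ M) (by simp [hnorm])
  have hle : ∀ a, ‖g (Submodule.Quotient.mk a)‖ ≤ 1 * ‖a‖ := fun a => by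
    rw [one_mul]
    refine (g.le_of_opNorm_le hg.le _).trans ?_
    rw [one_mul]
    exact Submodule.Quotient.norm_mk_le M a
  refine ⟨(g.toLinearMap ∘ₗ M.mkQ).mkContinuous 1 hle, LinearMap.mkContinuous_norm_le _ zero_le_one _,
    ?_, fun a => ?_⟩
  · change g (Submodule.Quotient.mk 1) = 1
    rw [hg1, hnorm]; simp
  · change g (Submodule.Quotient.mk (α a)) = g (Submodule.Quotient.mk a)
    congr 1
    rw [Submodule.Quotient.eq]
    exact ⟨a, rfl⟩

namespace CovariantRep

universe u

/-- The GNS representation of an invariant positive functional is covariant. -/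
theorem nonempty_of_nontrivial {A : Type u} [CStarAlgebra A] [Nontrivial A] (α : A ≃⋆ₐ[ℂ] A) :
    Nonempty (CovariantRep α) := by
  let _ := CStarAlgebra.spectralOrder A
  let _ := CStarAlgebra.spectralOrderedRing A
  obtain ⟨f₀, hf, hf1, hinv⟩ := exists_invariant_functional α
  let f : A →ₚ[ℂ] ℂ := PositiveLinearMap.mk₀ f₀.toLinearMap
    fun a ha => f₀.nonneg_of_norm_le_one hf hf1 ha
  have hff : ∀ a, f a = f₀ a := fun a => rfl
  have hnorm : ∀ (β : A ≃⋆ₐ[ℂ] A), (∀ a, f₀ (β a) = f₀ a) → ∀ a : f.PreGNS,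
      ‖f.toPreGNS (β (f.ofPreGNS a))‖ = ‖a‖ := by
    intro β hβ a
    rw [f.preGNS_norm_def, f.preGNS_norm_def, f.ofPreGNS_toPreGNS, ← map_star, ← map_mul, hff, hff,
      hβ]
  -- Invariance of `f₀` makes `α` isometric for the GNS seminorm; its extension to the completion is
  -- the required unitary, with inverse coming from `α.symm`.
  let V : (β : A ≃⋆ₐ[ℂ] A) → (∀ a, f₀ (β a) = f₀ a) → (f.PreGNS →L[ℂ] f.PreGNS) := fun β hβ =>
    (f.toPreGNS.toLinearMap ∘ₗ (β : A →⋆ₐ[ℂ] A).toAlgHom.toLinearMap ∘ₗ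
      f.ofPreGNS.toLinearMap).mkContinuous 1 fun a => by rw [one_mul]; exact (hnorm β hβ a).le
  have hV : ∀ β hβ a, V β hβ a = f.toPreGNS (β (f.ofPreGNS a)) := fun _ _ _ => rfl
  have hinv' : ∀ a, f₀ (α.symm a) = f₀ a := fun a => by
    rw [← hinv (α.symm a), StarAlgEquiv.apply_symm_apply]
  let U : f.GNS →L[ℂ] f.GNS := (V α hinv).completion
  let U' : f.GNS →L[ℂ] f.GNS := (V α.symm hinv').completion
  have hUU' : U * U' = 1 := by
    ext x
    induction x using induction_on with
    | hp => exact isClosed_eq (U * U').continuous (1 : f.GNS →L[ℂ] f.GNS).continuous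
    | ih x => simp [U, U', hV]
  have hU'U : U' * U = 1 := by
    ext x
    induction x using induction_on with
    | hp => exact isClosed_eq (U' * U).continuous (1 : f.GNS →L[ℂ] f.GNS).continuous
    | ih x => simp [U, U', hV]
  have hstar : star U = U' := by
    refine ((ContinuousLinearMap.eq_adjoint_iff U' U).2 fun x y => ?_).symm
    induction x, y using induction_on₂ with
    | hp => apply isClosed_eq <;> fun_prop
    | ih x y =>
      simp only [U, U', ContinuousLinearMap.completion_apply_coe, inner_coe, hV,
        f.preGNS_inner_def, f.ofPreGNS_toPreGNS, hff]
      rw [← hinv, map_mul, map_star, StarAlgEquiv.apply_symm_apply]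
  have hnontriv : Nontrivial f.GNS := by
    refine ⟨⟨(f.toPreGNS 1 : f.PreGNS), 0, fun h => ?_⟩⟩
    have h2 : ‖((f.toPreGNS 1 : f.PreGNS) : f.GNS)‖ = 0 := by rw [h, norm_zero]
    rw [norm_coe, f.preGNS_norm_def] at h2
    simp [hff, hf1] at h2
  exact ⟨{
    H := f.GNS
    π := f.gnsStarAlgHom
    U := ⟨U, by rw [Unitary.mem_iff, hstar]; exact ⟨hU'U, hUU'⟩⟩
    covariant := fun a => by
      change U * f.gnsStarAlgHom a * star U = f.gnsStarAlgHom (α a)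
      rw [hstar]
      ext x
      induction x using induction_on with
      | hp =>
        exact isClosed_eq (U * f.gnsStarAlgHom a * U').continuous
          (f.gnsStarAlgHom (α a)).continuous
      | ih x => simp [U, U', hV] }⟩

end CovariantRep

end

/-! ### The circle action and faithfulness of its averages -/

section

universe u

open Topology Filter
open scoped InnerProductSpace

namespace CovariantRep

variable {A : Type u} [CStarAlgebra A] {α : A ≃⋆ₐ[ℂ] A}

/-- The covariant representation `(π, zU)`. -/
@[reducible]
noncomputable def twist (ρ : CovariantRep α) (z : unitary ℂ) : CovariantRep α where
  H := ρ.H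
  π := ρ.π
  U := z • ρ.U
  covariant a := by
    have hs : star ((z : ℂ) • (ρ.U : ρ.H →L[ℂ] ρ.H)) = star (z : ℂ) • star (ρ.U : ρ.H →L[ℂ] ρ.H) :=
      star_smul _ _
    change (z : ℂ) • (ρ.U : ρ.H →L[ℂ] ρ.H) * ρ.π a * star ((z : ℂ) • (ρ.U : ρ.H →L[ℂ] ρ.H)) = _
    rw [← ρ.covariant a, hs, smul_mul_assoc, smul_mul_smul_comm,
      Unitary.mul_star_self_of_mem z.2, one_smul]

theorem twist_one (ρ : CovariantRep α) : ρ.twist 1 = ρ := by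
  simp [twist]

/-- The representation of the crossed product given by a covariant representation. -/
noncomputable def eval (ρ : CovariantRep α) : CrossedProduct α →⋆ₐ[ℂ] (ρ.H →L[ℂ] ρ.H) where
  toFun b := (b : CrossedProduct.Ambient α) ρ
  map_one' := rfl
  map_mul' _ _ := rfl
  map_zero' := rfl
  map_add' _ _ := rfl
  commutes' _ := rfl
  map_star' _ := rfl

/-- The representation of the crossed product given by `(π, zU)`. -/
noncomputable def twistEval (ρ : CovariantRep α) (z : unitary ℂ) :
    CrossedProduct α →⋆ₐ[ℂ] (ρ.H →L[ℂ] ρ.H) :=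
  (ρ.twist z).eval

/-- The two representations share the space `ρ.H` definitionally, so the heterogeneous equality
coming from `twist_one` becomes an equality. -/
theorem twistEval_one (ρ : CovariantRep α) (b : CrossedProduct α) :
    ρ.twistEval 1 b = ρ.eval b :=
  eq_of_heq (congr_arg_heq (fun σ : CovariantRep α => σ.eval b) ρ.twist_one)

theorem coe_smul_zpow {H : Type*} [NormedAddCommGroup H] [InnerProductSpace ℂ H] [CompleteSpace H]
    (z : unitary ℂ) (U : unitary (H →L[ℂ] H)) (n : ℤ) :
    (((z • U) ^ n : unitary (H →L[ℂ] H)) : H →L[ℂ] H)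
      = ((z ^ n : unitary ℂ) : ℂ) • ((U ^ n : unitary (H →L[ℂ] H)) : H →L[ℂ] H) := by
  let T : Subgroup (unitary ℂ × unitary (H →L[ℂ] H) × unitary (H →L[ℂ] H)) :=
    { carrier := {p | (p.2.2 : H →L[ℂ] H) = (p.1 : ℂ) • (p.2.1 : H →L[ℂ] H)}
      one_mem' := (one_smul ℂ _).symm
      mul_mem' := fun {p q} hp hq => by
        change (p.2.2 : H →L[ℂ] H) * q.2.2 = ((p.1 : ℂ) * q.1) • ((p.2.1 : H →L[ℂ] H) * q.2.1)
        rw [hp, hq, smul_mul_smul_comm]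
      inv_mem' := fun {p} hp => by
        change star (p.2.2 : H →L[ℂ] H) = star (p.1 : ℂ) • star (p.2.1 : H →L[ℂ] H)
        rw [hp, star_smul] }
  exact T.zpow_mem (x := (z, U, z • U)) rfl n

end CovariantRep

namespace CrossedProduct

variable {A : Type u} [CStarAlgebra A] {α : A ≃⋆ₐ[ℂ] A}

noncomputable instance : CStarAlgebra (CrossedProduct α) := StarSubalgebra.cstarAlgebra _

variable (α) in
/-- The canonical map `A → C*(ℤ, A, α)`. -/
noncomputable def coeffHom : A →⋆ₐ[ℂ] CrossedProduct α :=
  StarAlgHom.codRestrict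
    { toFun := coeff α
      map_one' := Subtype.ext (funext fun ρ => map_one ρ.π)
      map_mul' := fun a b => Subtype.ext (funext fun ρ => map_mul ρ.π a b)
      map_zero' := Subtype.ext (funext fun ρ => map_zero ρ.π)
      map_add' := fun a b => Subtype.ext (funext fun ρ => map_add ρ.π a b)
      commutes' := fun r => Subtype.ext (funext fun ρ => by
        exact (AlgHomClass.commutes ρ.π r))
      map_star' := fun a => Subtype.ext (funext fun ρ => map_star ρ.π a) } (CrossedProduct α)
    fun a => StarSubalgebra.le_topologicalClosure _
      (StarAlgebra.subset_adjoin ℂ _ (Or.inl ⟨a, rfl⟩))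

variable (α) in
/-- The canonical unitary as an element of the crossed product. -/
noncomputable def unit : unitary (CrossedProduct α) :=
  ⟨⟨canonicalUnitary α, StarSubalgebra.le_topologicalClosure _
      (StarAlgebra.subset_adjoin ℂ _ (Or.inr rfl))⟩, by
    rw [Unitary.mem_iff]
    exact ⟨Subtype.ext (Subtype.ext (funext fun ρ => Unitary.star_mul_self_of_mem ρ.U.2)),
      Subtype.ext (Subtype.ext (funext fun ρ => Unitary.mul_star_self_of_mem ρ.U.2))⟩⟩

theorem eval_coeffHom (ρ : CovariantRep α) (a : A) : ρ.eval (coeffHom α a) = ρ.π a := rfl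

theorem eval_unit (ρ : CovariantRep α) : ρ.eval (unit α) = ρ.U := rfl

theorem norm_eval_le (ρ : CovariantRep α) (b : CrossedProduct α) : ‖ρ.eval b‖ ≤ ‖b‖ :=
  NonUnitalStarAlgHom.norm_apply_le ρ.eval b

theorem ext_eval {b c : CrossedProduct α} (h : ∀ ρ : CovariantRep α, ρ.eval b = ρ.eval c) :
    b = c :=
  Subtype.ext (Subtype.ext (funext h))

theorem unit_mul_coeffHom (a : A) :
    (unit α : CrossedProduct α) * coeffHom α a = coeffHom α (α a) * unit α := by
  refine ext_eval fun ρ => ?_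
  rw [map_mul, map_mul, eval_unit, eval_coeffHom, eval_coeffHom, ← ρ.covariant a, mul_assoc,
    mul_assoc, Unitary.coe_star_mul_self, mul_one]

theorem eval_laurentSum (ρ : CovariantRep α) (f : ℤ →₀ A) :
    ρ.eval (laurentSum (coeffHom α) (unit α) f) = laurentSum ρ.π ρ.U f :=
  map_laurentSum _ _ ρ.eval (eval_coeffHom ρ) (eval_unit ρ) f

/-- The finite sums `∑ aₙ uⁿ` are dense in the crossed product. -/
theorem exists_laurentSum_near (b : CrossedProduct α) {ε : ℝ} (hε : 0 < ε) :
    ∃ f : ℤ →₀ A, ‖laurentSum (coeffHom α) (unit α) f - b‖ < ε := by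
  have hmem : StarAlgebra.adjoin ℂ (Set.range (coeff α) ∪ {canonicalUnitary α}) ≤
      (laurentSubalgebra (unit_mul_coeffHom (α := α))).map (CrossedProduct α).subtype := by
    refine StarAlgebra.adjoin_le ?_
    rintro x (⟨a, rfl⟩ | rfl)
    · exact ⟨coeffHom α a, ⟨Finsupp.single 0 a, by simp⟩, rfl⟩
    · exact ⟨unit α, ⟨Finsupp.single 1 1, by simp⟩, rfl⟩
  obtain ⟨x, hx, hbx⟩ := Metric.mem_closure_iff.1
    (show (b : Ambient α) ∈ closure (_ : Set (Ambient α)) from b.2) ε hε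
  obtain ⟨_, ⟨f, rfl⟩, rfl⟩ := hmem hx
  refine ⟨f, ?_⟩
  rwa [dist_comm, dist_eq_norm] at hbx

/-- The point of the circle with angle `t`. -/
noncomputable def circlePoint (t : ℝ) : unitary ℂ :=
  ⟨Complex.exp (t * Complex.I), by
    rw [Unitary.mem_iff_star_mul_self, RCLike.star_def, ← Complex.exp_conj, ← Complex.exp_add]
    simp⟩

theorem coe_circlePoint_zpow (t : ℝ) (n : ℤ) :
    ((circlePoint t ^ n : unitary ℂ) : ℂ) = Complex.exp (n * Complex.I * t) := by
  rw [Unitary.coe_zpow, circlePoint, ← Complex.exp_int_mul]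
  congr 1
  ring

/-- A matrix coefficient of the dual action of the circle. -/
noncomputable def dualCoeff (ρ : CovariantRep α) (ξ : ρ.H) (b : CrossedProduct α) (t : ℝ) : ℂ :=
  ⟪ξ, ρ.twistEval (circlePoint t) b ξ⟫_ℂ

theorem dualCoeff_sub (ρ : CovariantRep α) (ξ : ρ.H) (b c : CrossedProduct α) (t : ℝ) :
    dualCoeff ρ ξ (b - c) t = dualCoeff ρ ξ b t - dualCoeff ρ ξ c t := by
  simp only [dualCoeff, map_sub]
  exact inner_sub_right _ _ _

theorem norm_dualCoeff_le (ρ : CovariantRep α) (ξ : ρ.H) (b : CrossedProduct α) (t : ℝ) :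
    ‖dualCoeff ρ ξ b t‖ ≤ ‖b‖ * ‖ξ‖ ^ 2 := by
  calc _ ≤ ‖ξ‖ * ‖ρ.twistEval (circlePoint t) b ξ‖ :=
        norm_inner_le_norm _ _
    _ ≤ ‖ξ‖ * (‖b‖ * ‖ξ‖) := by
        gcongr
        exact ContinuousLinearMap.le_of_opNorm_le _ (norm_eval_le (ρ.twist _) b) ξ
    _ = _ := by ring

theorem dualCoeff_laurentSum (ρ : CovariantRep α) (ξ : ρ.H) (f : ℤ →₀ A) (t : ℝ) :
    dualCoeff ρ ξ (laurentSum (coeffHom α) (unit α) f) t = ∑ n ∈ f.support,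
      Complex.exp (n * Complex.I * t) *
        ⟪ξ, (ρ.π (f n) * ((ρ.U ^ n : unitary (ρ.H →L[ℂ] ρ.H)) : ρ.H →L[ℂ] ρ.H)) ξ⟫_ℂ := by
  have h : ρ.twistEval (circlePoint t) (laurentSum (coeffHom α) (unit α) f)
      = laurentSum ρ.π (circlePoint t • ρ.U) f := eval_laurentSum (ρ.twist (circlePoint t)) f
  rw [dualCoeff, h]
  rw [laurentSum_apply, _root_.sum_apply, inner_sum]
  refine Finset.sum_congr rfl fun n _ => ?_
  rw [CovariantRep.coe_smul_zpow, mul_smul_comm, _root_.smul_apply, inner_smul_right, coe_circlePoint_zpow]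

theorem continuous_dualCoeff_laurentSum (ρ : CovariantRep α) (ξ : ρ.H) (f : ℤ →₀ A) :
    Continuous (dualCoeff ρ ξ (laurentSum (coeffHom α) (unit α) f)) := by
  simp only [funext (dualCoeff_laurentSum ρ ξ f)]
  fun_prop

/-- A uniform limit of trigonometric polynomials: the bound `norm_dualCoeff_le` does not depend on
`t`. -/
theorem continuous_dualCoeff (ρ : CovariantRep α) (ξ : ρ.H) (b : CrossedProduct α) :
    Continuous (dualCoeff ρ ξ b) := by
  refine continuous_of_uniform_approx_of_continuous fun V hV => ?_
  obtain ⟨ε, hε, hεV⟩ := Metric.mem_uniformity_dist.1 hV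
  obtain ⟨f, hf⟩ := exists_laurentSum_near b (ε := ε / (‖ξ‖ ^ 2 + 1)) (by positivity)
  refine ⟨_, continuous_dualCoeff_laurentSum ρ ξ f, fun t => hεV ?_⟩
  rw [dist_comm, dist_eq_norm, ← dualCoeff_sub]
  calc _ ≤ _ := norm_dualCoeff_le ρ ξ _ t
    _ ≤ ‖laurentSum (coeffHom α) (unit α) f - b‖ * (‖ξ‖ ^ 2 + 1) := by gcongr; linarith
    _ < ε / (‖ξ‖ ^ 2 + 1) * (‖ξ‖ ^ 2 + 1) := by gcongr
    _ = ε := by field_simp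

/-- Nontrivial characters integrate to zero over the circle. This average plays the role of the
conditional expectation onto `A`. -/
theorem integral_dualCoeff_laurentSum (ρ : CovariantRep α) (ξ : ρ.H) (f : ℤ →₀ A) :
    ∫ t in (0 : ℝ)..(2 * Real.pi), dualCoeff ρ ξ (laurentSum (coeffHom α) (unit α) f) t
      = 2 * Real.pi * ⟪ξ, ρ.π (f 0) ξ⟫_ℂ := by
  simp only [dualCoeff_laurentSum]
  rw [intervalIntegral.integral_finsetSum
    (fun n _ => Continuous.intervalIntegrable (by fun_prop) _ _)]
  rw [Finset.sum_eq_single (0 : ℤ)]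
  · simp
  · intro n _ hn
    rw [intervalIntegral.integral_mul_const, integral_exp_mul_complex (by simp [hn])]
    have : (n : ℂ) * Complex.I * ((2 * Real.pi : ℝ) : ℂ) = n * (2 * Real.pi * Complex.I) := by
      push_cast; ring
    rw [this, Complex.exp_int_mul_two_pi_mul_I]
    simp
  · intro h0
    simp [Finsupp.notMem_support_iff.1 h0]

/-- An ideal in whose cosets the zeroth coefficient is bounded by the norm is zero. -/
theorem eq_bot_of_norm_apply_zero_le (I : TwoSidedIdeal (CrossedProduct α))
    (hI : ∀ (f : ℤ →₀ A), ∀ b ∈ I, ‖f 0‖ ≤ ‖laurentSum (coeffHom α) (unit α) f + b‖) :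
    I = ⊥ := by
  have hzero : ∀ b ∈ I, ∀ (ρ : CovariantRep α) (ξ : ρ.H),
      ∫ t in (0 : ℝ)..(2 * Real.pi), dualCoeff ρ ξ b t = 0 := by
    intro b hb ρ ξ
    rw [← norm_le_zero_iff]
    refine le_of_forall_pos_le_add fun ε hε => ?_
    -- Two errors, each at most `2 * π * δ * ‖ξ‖ ^ 2`, must add up to at most `ε`; the `+ 1` covers
    -- `ξ = 0`.
    set δ := ε / (4 * Real.pi * (‖ξ‖ ^ 2 + 1)) with hδ
    have hδ0 : 0 < δ := by positivity
    obtain ⟨f, hf⟩ := exists_laurentSum_near b hδ0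
    have hf0 : ‖f 0‖ ≤ δ := by
      refine (hI f (-b) (I.neg_mem hb)).trans ?_
      rw [← sub_eq_add_neg]; exact hf.le
    have h1 : ∫ t in (0 : ℝ)..(2 * Real.pi), dualCoeff ρ ξ b t
        = 2 * Real.pi * ⟪ξ, ρ.π (f 0) ξ⟫_ℂ - ∫ t in (0 : ℝ)..(2 * Real.pi),
          dualCoeff ρ ξ (laurentSum (coeffHom α) (unit α) f - b) t := by
      simp only [dualCoeff_sub]
      rw [intervalIntegral.integral_sub
        ((continuous_dualCoeff ρ ξ _).intervalIntegrable _ _)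
        ((continuous_dualCoeff ρ ξ _).intervalIntegrable _ _), integral_dualCoeff_laurentSum]
      ring
    have h2 : ‖∫ t in (0 : ℝ)..(2 * Real.pi),
        dualCoeff ρ ξ (laurentSum (coeffHom α) (unit α) f - b) t‖
        ≤ δ * ‖ξ‖ ^ 2 * |2 * Real.pi - 0| :=
      intervalIntegral.norm_integral_le_of_norm_le_const fun t _ =>
        (norm_dualCoeff_le ρ ξ _ t).trans (by gcongr)
    have h3 : ‖⟪ξ, ρ.π (f 0) ξ⟫_ℂ‖ ≤ δ * ‖ξ‖ ^ 2 := by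
      calc _ ≤ ‖ξ‖ * ‖ρ.π (f 0) ξ‖ := norm_inner_le_norm _ _
        _ ≤ ‖ξ‖ * (δ * ‖ξ‖) := by
            gcongr
            exact ContinuousLinearMap.le_of_opNorm_le _
              ((NonUnitalStarAlgHom.norm_apply_le ρ.π _).trans hf0) ξ
        _ = _ := by ring
    rw [h1, zero_add]
    refine (norm_sub_le _ _).trans ?_
    have h4 : ‖(2 * Real.pi : ℂ)‖ = 2 * Real.pi := by
      simp [abs_of_pos Real.pi_pos]
    rw [norm_mul, h4]
    rw [sub_zero, abs_of_pos Real.two_pi_pos] at h2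
    calc _ ≤ 2 * Real.pi * (δ * ‖ξ‖ ^ 2) + δ * ‖ξ‖ ^ 2 * (2 * Real.pi) := by gcongr
      _ = δ * (4 * Real.pi * ‖ξ‖ ^ 2) := by ring
      _ ≤ δ * (4 * Real.pi * (‖ξ‖ ^ 2 + 1)) := by gcongr; linarith
      _ = ε := by rw [hδ]; field_simp
  rw [eq_bot_iff]
  intro b hb
  rw [TwoSidedIdeal.mem_bot]
  refine ext_eval fun ρ => ?_
  rw [map_zero]
  ext ξ
  -- Faithfulness: for `star b * b ∈ I` the integrand is continuous and nonnegative with zero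
  -- integral, so it vanishes at `t = 0`, where the twist is trivial.
  have hsq : ∀ t, dualCoeff ρ ξ (star b * b) t =
      ((‖ρ.twistEval (circlePoint t) b ξ‖ ^ 2 : ℝ) : ℂ) := by
    intro t
    rw [dualCoeff, map_mul, map_star]
    change ⟪ξ, star (ρ.twistEval (circlePoint t) b)
      (ρ.twistEval (circlePoint t) b ξ)⟫_ℂ = _
    rw [ContinuousLinearMap.star_eq_adjoint, ContinuousLinearMap.adjoint_inner_right,
      inner_self_eq_norm_sq_to_K]
    simp
  have hint := hzero _ (I.mul_mem_left (star b) b hb) ρ ξ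
  have hcont := continuous_dualCoeff ρ ξ (star b * b)
  have hre : Continuous fun t => ‖ρ.twistEval (circlePoint t) b ξ‖ ^ 2 := by
    convert Complex.continuous_re.comp hcont using 2 with t
    rw [Function.comp_apply, hsq, Complex.ofReal_re]
  simp only [hsq] at hint
  rw [intervalIntegral.integral_ofReal, Complex.ofReal_eq_zero] at hint
  by_contra hne
  refine (intervalIntegral.integral_pos Real.two_pi_pos hre.continuousOn
    (fun t _ => by positivity) ⟨0, ⟨le_rfl, Real.two_pi_pos.le⟩, ?_⟩).ne' hint
  have h1 : circlePoint 0 = 1 := Subtype.ext (by simp [circlePoint])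
  rw [h1, ρ.twistEval_one]
  have : ρ.eval b ξ ≠ 0 := hne
  positivity

end CrossedProduct

end

theorem mainTheorem4 {X A : Type*} [TopologicalSpace X] [CompactSpace X] [T2Space X] [Infinite X]
    [CStarAlgebra A] (S : CXAlgebra X A) (hcont : S.IsContinuous)
    (hfib : ∀ x : X, IsTopologicallySimple (S.Fiber x))
    (h : X ≃ₜ X) (hmin : IsMinimalHomeo h)
    (α : A ≃⋆ₐ[ℂ] A) (hα : S.LiesOver α h) :
    IsTopologicallySimple (CrossedProduct α) := by
  obtain ⟨x₀⟩ : Nonempty X := inferInstance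
  have hA : Nontrivial A := by
    have := (hfib x₀).1
    exact (Ideal.Quotient.mk_surjective (I := S.fiberIdeal x₀)).nontrivial
  refine ⟨?_, fun I hI => ?_⟩
  · obtain ⟨ρ⟩ := CovariantRep.nonempty_of_nontrivial α
    exact RingHom.domain_nontrivial (ρ.eval.toAlgHom.toRingHom)
  refine (eq_zero_of_coeff_mem_or_eq_top (CrossedProduct.unit_mul_coeffHom (α := α)) S hcont hfib
    hmin hα I hI).imp (fun hI0 => ?_) id
  exact CrossedProduct.eq_bot_of_norm_apply_zero_le I fun f b hb =>
    norm_apply_zero_le_norm_laurentSum_add (CrossedProduct.unit_mul_coeffHom (α := α)) S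
      (fun n hn x => hmin.zpow_apply_ne hn x) hα I hI0 f hb
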